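/- Let $(\mathfrak g,J,\omega)$ be a four-dimensional real Kähler Lie algebra, that is: $\mathfrak g$ is a real Lie algebra of dimension $4$; $J:\mathfrak g\to\mathfrak g$ is linear with $J^2=-I$ and $[Jx,Jy]-[x,y]-J[Jx,y]-J[x,Jy]=0$ for all $x,y\in\mathfrak g$; and $\omega$ is a non-degenerate alternating bilinear form on $\mathfrak g$ that is closed, $\omega([x,y],z)+\omega([y,z],x)+\omega([z,x],y)=0$, and satisfies $\omega(Jx,Jy)=\omega(x,y)$. Let $g(x,y)=\omega(Jx,y)$ be the associated, possibly indefinite, pseudo-Riemannian metric. Assume that there is an abelian ideal $\mathfrak h$ of $\mathfrak g$ such that $J\mathfrak h$ is a Lie subalgebra and there is a split short exact sequence of Lie algebras $$0\longrightarrow\mathfrak h\longrightarrow\mathfrak g\longrightarrow J\mathfrak h\longrightarrow 0,$$ in which $\mathfrak h\to\mathfrak g$ is the inclusion and the splitting is the inclusion $J\mathfrak h\to\mathfrak g$, and such that the resulting sum $\mathfrak g=\mathfrak h\oplus J\mathfrak h$ is orthogonal with respect to $g$. Then $\mathfrak g$ is isomorphic, as a real Lie algebra, to one of $$\mathbb R^4,\quad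 \mathbb R\times\mathfrak h_3,\quad \mathbb R^2\times\mathfrak{aff}(\mathbb R),\quad \mathfrak{aff}(\mathbb C),\quad \mathfrak{aff}(\mathbb R)\times\mathfrak{aff}(\mathbb R),\quad \mathfrak r_{4,-1,-1},\quad \mathfrak d_{4,1},\quad \mathfrak d_{4,2},\quad \mathfrak d_{4,1/2}.$$ Here $\mathbb R^n$ is abelian; $\mathfrak h_3$ is the Heisenberg Lie algebra with basis $e_1,e_2,e_3$ and $[e_1,e_2]=e_3$; for $A=\mathbb R$ or $\mathbb C$, $\mathfrak{aff}(A)$ is the real Lie algebra $A\oplus A$ with $[(a,b),(c,d)]=(0,ad-cb)$; $\mathfrak r_{4,\alpha,\beta}$ has a basis $e_1,\dots,e_4$ with $[e_4,e_1]=e_1$, $[e_4,e_2]=\alpha e_2$, $[e_4,e_3]=\beta e_3$; and $\mathfrak d_{4,\lambda}$ has a basis $e_1,\dots,e_4$ with $[e_1,e_2]=e_3$, $[e_4,e_3]=e_3$, $[e_4,e_1]=\lambda e_1$, $[e_4,e_2]=(1-\lambda)e_2$ (in each case the brackets of basis vectors not determined by these through antisymmetry vanish). -/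

import Mathlib

/-- A Kähler structure `(J, ω)` on a real Lie algebra: an integrable almost complex structure `J`
together with a compatible symplectic form `ω`. -/
structure KahlerStructure (L : Type*) [LieRing L] [LieAlgebra ℝ L] where
  /-- the complex structure -/
  J : L →ₗ[ℝ] L
  /-- the symplectic form -/
  ω : LinearMap.BilinForm ℝ L
  J_sq : ∀ x, J (J x) = -x
  /-- vanishing of the Nijenhuis tensor -/
  integrable : ∀ x y, ⁅J x, J y⁆ - ⁅x, y⁆ - J ⁅J x, y⁆ - J ⁅x, J y⁆ = 0
  alt : ω.IsAlt
  nondegenerate : ω.Nondegenerate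
  closed : ∀ x y z, ω ⁅x, y⁆ z + ω ⁅y, z⁆ x + ω ⁅z, x⁆ y = 0
  compatible : ∀ x y, ω (J x) (J y) = ω x y

/-- The pseudo-Riemannian metric `g(x, y) = ω(J x, y)` of a Kähler structure. -/
def KahlerStructure.metric {L : Type*} [LieRing L] [LieAlgebra ℝ L] (K : KahlerStructure L) :
    LinearMap.BilinForm ℝ L :=
  K.ω ∘ₗ K.J

/-- The ideal `h` gives a split short exact sequence of Lie algebras `0 → h → L → J h → 0` whose
sum `L = h ⊕ J h` is orthogonal: `J h` is a Lie subalgebra `k` of `L`, there is a homomorphism of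
Lie algebras `π : L → k` which makes the sequence exact, the inclusion of `k` in `L` is a section
of `π`, and `h` is orthogonal to `k` for the metric. -/
def KahlerStructure.IsOrthogonalSplit {L : Type*} [LieRing L] [LieAlgebra ℝ L]
    (K : KahlerStructure L) (h : LieIdeal ℝ L) : Prop :=
  ∃ k : LieSubalgebra ℝ L,
    k.toSubmodule = h.toSubmodule.map K.J ∧
    (∃ π : L →ₗ⁅ℝ⁆ k, LieAlgebra.IsExtension h.incl π ∧ π.comp k.incl = LieHom.id) ∧
    ∀ x ∈ h, ∀ y ∈ k, K.metric x y = 0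

/-- The abelian Lie algebra `ℝⁿ`. -/
def AbelianLie (n : ℕ) : Type := Fin n → ℝ

namespace AbelianLie

noncomputable instance (n : ℕ) : AddCommGroup (AbelianLie n) :=
  inferInstanceAs (AddCommGroup (Fin n → ℝ))

noncomputable instance (n : ℕ) : Module ℝ (AbelianLie n) :=
  inferInstanceAs (Module ℝ (Fin n → ℝ))

noncomputable instance (n : ℕ) : LieRing (AbelianLie n) where
  bracket _ _ := 0
  add_lie _ _ _ := (add_zero 0).symm
  lie_add _ _ _ := (add_zero 0).symm
  lie_self _ := rfl
  leibniz_lie _ _ _ := (add_zero 0).symm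

noncomputable instance (n : ℕ) : LieAlgebra ℝ (AbelianLie n) where
  lie_smul t _ _ := (smul_zero t).symm

end AbelianLie

/-- The real Lie algebra `aff(A)` of a commutative real algebra `A`: the space `A × A` with
`[(a, b), (c, d)] = (0, a d - c b)`. For `A = ℝ` it is the Lie algebra of the group of affine
motions of the line, for `A = ℂ` the real Lie algebra underlying that of the affine motions of
the complex line. -/
def Aff (A : Type) : Type := A × A

namespace Aff

variable (A : Type) [CommRing A] [Algebra ℝ A]

instance : AddCommGroup (Aff A) := inferInstanceAs (AddCommGroup (A × A))

instance : Module ℝ (Aff A) := inferInstanceAs (Module ℝ (A × A))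

instance : LieRing (Aff A) where
  bracket x y := ((0, x.1 * y.2 - y.1 * x.2) : A × A)
  add_lie x y z := Prod.ext (add_zero (0 : A)).symm
    (show (x.1 + y.1) * z.2 - z.1 * (x.2 + y.2) = (x.1 * z.2 - z.1 * x.2) +
      (y.1 * z.2 - z.1 * y.2) by ring)
  lie_add x y z := Prod.ext (add_zero (0 : A)).symm
    (show x.1 * (y.2 + z.2) - (y.1 + z.1) * x.2 = (x.1 * y.2 - y.1 * x.2) +
      (x.1 * z.2 - z.1 * x.2) by ring)
  lie_self x := Prod.ext rfl (sub_self (x.1 * x.2))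
  leibniz_lie x y z := Prod.ext (add_zero (0 : A)).symm
    (show x.1 * (y.1 * z.2 - z.1 * y.2) - 0 * x.2 =
      (0 * z.2 - z.1 * (x.1 * y.2 - y.1 * x.2)) + (y.1 * (x.1 * z.2 - z.1 * x.2) - 0 * y.2) by
      ring)

instance : LieAlgebra ℝ (Aff A) where
  lie_smul t x y := Prod.ext (smul_zero t).symm
    (show x.1 * (t • y.2) - (t • y.1) * x.2 = t • (x.1 * y.2 - y.1 * x.2) by
      rw [mul_smul_comm, smul_mul_assoc, smul_sub])

end Aff

/-- The three-dimensional Heisenberg Lie algebra `h₃`, in coordinates for a basis `e₁, e₂, e₃`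
with `[e₁, e₂] = e₃`. -/
def Heis3 : Type := Fin 3 → ℝ

namespace Heis3

noncomputable instance : AddCommGroup Heis3 := inferInstanceAs (AddCommGroup (Fin 3 → ℝ))

noncomputable instance : Module ℝ Heis3 := inferInstanceAs (Module ℝ (Fin 3 → ℝ))

/-- The bracket of `h₃`. -/
def bracket (x y : Fin 3 → ℝ) : Fin 3 → ℝ := ![0, 0, x 0 * y 1 - x 1 * y 0]

theorem add_bracket (x y z : Fin 3 → ℝ) :
    bracket (x + y) z = bracket x z + bracket y z := by
  ext i; fin_cases i <;> simp [bracket] <;> ring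

theorem bracket_add (x y z : Fin 3 → ℝ) :
    bracket x (y + z) = bracket x y + bracket x z := by
  ext i; fin_cases i <;> simp [bracket] <;> ring

theorem bracket_self (x : Fin 3 → ℝ) : bracket x x = 0 := by
  ext i; fin_cases i <;> simp [bracket]; ring

theorem bracket_leibniz (x y z : Fin 3 → ℝ) :
    bracket x (bracket y z) = bracket (bracket x y) z + bracket y (bracket x z) := by
  ext i; fin_cases i <;> simp [bracket]

theorem bracket_smul (t : ℝ) (x y : Fin 3 → ℝ) :
    bracket x (t • y) = t • bracket x y := by
  ext i; fin_cases i <;> simp [bracket] <;> ring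

noncomputable instance : LieRing Heis3 where
  bracket := bracket
  add_lie := add_bracket
  lie_add := bracket_add
  lie_self := bracket_self
  leibniz_lie := bracket_leibniz

noncomputable instance : LieAlgebra ℝ Heis3 where
  lie_smul := bracket_smul

end Heis3

/-- The Lie algebra `r_{4,α,β}`, in coordinates for a basis `e₁, e₂, e₃, e₄` with
`[e₄, e₁] = e₁`, `[e₄, e₂] = α e₂`, `[e₄, e₃] = β e₃`. -/
def LieR4 (_α _β : ℝ) : Type := Fin 4 → ℝ

namespace LieR4

variable (α β : ℝ)

noncomputable instance : AddCommGroup (LieR4 α β) := inferInstanceAs (AddCommGroup (Fin 4 → ℝ))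

noncomputable instance : Module ℝ (LieR4 α β) := inferInstanceAs (Module ℝ (Fin 4 → ℝ))

/-- The bracket of `r_{4,α,β}`. -/
def bracket (x y : Fin 4 → ℝ) : Fin 4 → ℝ :=
  ![x 3 * y 0 - x 0 * y 3, α * (x 3 * y 1 - x 1 * y 3), β * (x 3 * y 2 - x 2 * y 3), 0]

theorem add_bracket (x y z : Fin 4 → ℝ) :
    bracket α β (x + y) z = bracket α β x z + bracket α β y z := by
  ext i; fin_cases i <;> simp [bracket] <;> ring

theorem bracket_add (x y z : Fin 4 → ℝ) :
    bracket α β x (y + z) = bracket α β x y + bracket α β x z := by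
  ext i; fin_cases i <;> simp [bracket] <;> ring

theorem bracket_self (x : Fin 4 → ℝ) : bracket α β x x = 0 := by
  ext i; fin_cases i <;> simp [bracket] <;> ring_nf <;> simp

theorem bracket_leibniz (x y z : Fin 4 → ℝ) :
    bracket α β x (bracket α β y z) = bracket α β (bracket α β x y) z + bracket α β y (bracket α β x z) := by
  ext i; fin_cases i <;> simp [bracket] <;> ring

theorem bracket_smul (t : ℝ) (x y : Fin 4 → ℝ) :
    bracket α β x (t • y) = t • bracket α β x y := by
  ext i; fin_cases i <;> simp [bracket] <;> ring

noncomputable instance : LieRing (LieR4 α β) where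
  bracket := bracket α β
  add_lie := add_bracket α β
  lie_add := bracket_add α β
  lie_self := bracket_self α β
  leibniz_lie := bracket_leibniz α β

noncomputable instance : LieAlgebra ℝ (LieR4 α β) where
  lie_smul := bracket_smul α β

end LieR4

/-- The Lie algebra `d_{4,c}`, in coordinates for a basis `e₁, e₂, e₃, e₄` with
`[e₁, e₂] = e₃`, `[e₄, e₃] = e₃`, `[e₄, e₁] = c e₁`, `[e₄, e₂] = (1 - c) e₂`. -/
def LieD4 (_c : ℝ) : Type := Fin 4 → ℝ

namespace LieD4

variable (c : ℝ)

noncomputable instance : AddCommGroup (LieD4 c) := inferInstanceAs (AddCommGroup (Fin 4 → ℝ))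

noncomputable instance : Module ℝ (LieD4 c) := inferInstanceAs (Module ℝ (Fin 4 → ℝ))

/-- The bracket of `d_{4,c}`. -/
def bracket (x y : Fin 4 → ℝ) : Fin 4 → ℝ :=
  ![c * (x 3 * y 0 - x 0 * y 3), (1 - c) * (x 3 * y 1 - x 1 * y 3),
    (x 0 * y 1 - x 1 * y 0) + (x 3 * y 2 - x 2 * y 3), 0]

theorem add_bracket (x y z : Fin 4 → ℝ) :
    bracket c (x + y) z = bracket c x z + bracket c y z := by
  ext i; fin_cases i <;> simp [bracket] <;> ring

theorem bracket_add (x y z : Fin 4 → ℝ) :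
    bracket c x (y + z) = bracket c x y + bracket c x z := by
  ext i; fin_cases i <;> simp [bracket] <;> ring

theorem bracket_self (x : Fin 4 → ℝ) : bracket c x x = 0 := by
  ext i; fin_cases i <;> simp [bracket] <;> ring_nf <;> simp

theorem bracket_leibniz (x y z : Fin 4 → ℝ) :
    bracket c x (bracket c y z) = bracket c (bracket c x y) z + bracket c y (bracket c x z) := by
  ext i; fin_cases i <;> simp [bracket] <;> ring

theorem bracket_smul (t : ℝ) (x y : Fin 4 → ℝ) :
    bracket c x (t • y) = t • bracket c x y := by
  ext i; fin_cases i <;> simp [bracket] <;> ring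

noncomputable instance : LieRing (LieD4 c) where
  bracket := bracket c
  add_lie := add_bracket c
  lie_add := bracket_add c
  lie_self := bracket_self c
  leibniz_lie := bracket_leibniz c

noncomputable instance : LieAlgebra ℝ (LieD4 c) where
  lie_smul := bracket_smul c

end LieD4

/-! The product `x * y = ⁅J x, y⁆` turns the abelian ideal `h` into a left-symmetric algebra `A`.
Since the Nijenhuis tensor vanishes, `J` carries the commutator of this product to the bracket of
`J h`, so `L` is the semidirect product of the commutator Lie algebra of `A` with the vector space
`A`, acting by left multiplication. Closedness of `ω` says that the metric restricts to a Hessian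
metric on `A`. There are few such `A` of dimension two: if `A` is commutative it is associative, and
its idempotents decide its multiplication table; otherwise `⁅x, y⁆ = y` for some `x` and some
`y ≠ 0`, left multiplication by `y` is nilpotent, hence squares to zero, and the Codazzi equation
restricts what is left to three tables. -/

theorem linearIndependent_comp_fin_four {R V : Type*} [Ring R] [AddCommGroup V] [Module R V]
    {v : Fin 4 → V} (hv : LinearIndependent R v) {σ : Fin 4 → Fin 4} (hσ : σ.Injective) :
    LinearIndependent R ![v (σ 0), v (σ 1), v (σ 2), v (σ 3)] := by
  have heta : ![v (σ 0), v (σ 1), v (σ 2), v (σ 3)] = v ∘ σ := FinVec.etaExpand_eq (v ∘ σ)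
  exact heta ▸ hv.comp σ hσ

theorem lie_sum_fin_four {R L : Type*} [CommRing R] [LieRing L] [LieAlgebra R L]
    (v : Fin 4 → L) (p q : Fin 4 → R) :
    ⁅∑ i, p i • v i, ∑ i, q i • v i⁆ =
      (p 0 * q 1 - p 1 * q 0) • ⁅v 0, v 1⁆ + (p 0 * q 2 - p 2 * q 0) • ⁅v 0, v 2⁆ +
      (p 0 * q 3 - p 3 * q 0) • ⁅v 0, v 3⁆ + (p 1 * q 2 - p 2 * q 1) • ⁅v 1, v 2⁆ +
      (p 1 * q 3 - p 3 * q 1) • ⁅v 1, v 3⁆ + (p 2 * q 3 - p 3 * q 2) • ⁅v 2, v 3⁆ := by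
  simp only [Fin.sum_univ_four, lie_add, add_lie, lie_smul, smul_lie, lie_self]
  rw [← lie_skew (v 1) (v 0), ← lie_skew (v 2) (v 0), ← lie_skew (v 3) (v 0),
    ← lie_skew (v 2) (v 1), ← lie_skew (v 3) (v 1), ← lie_skew (v 3) (v 2)]
  module

theorem nonempty_lieEquiv_of_linearIndependent {K ι L M : Type*} [Field K] [Fintype ι]
    [Nonempty ι] [LieRing L] [LieAlgebra K L] [LieRing M] [LieAlgebra K M]
    (hdim : Fintype.card ι = Module.finrank K L) (φ : M ≃ₗ[K] (ι → K)) {v : ι → L}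
    (hv : LinearIndependent K v)
    (hlie : ∀ p q : M, ⁅∑ i, φ p i • v i, ∑ i, φ q i • v i⁆ = ∑ i, φ ⁅p, q⁆ i • v i) :
    Nonempty (L ≃ₗ⁅K⁆ M) := by
  let b := basisOfLinearIndependentOfCardEqFinrank hv hdim
  let e : M ≃ₗ[K] L := φ.trans b.equivFun.symm
  have he : ∀ p, e p = ∑ i, φ p i • v i := fun p => by
    simp [e, b, Module.Basis.equivFun_symm_apply]
  refine ⟨LieEquiv.symm { e with map_lie' := ?_ }⟩
  intro p q
  change e ⁅p, q⁆ = ⁅e p, e q⁆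
  rw [he, he, he, hlie]

section Models

variable {L : Type*} [LieRing L] [LieAlgebra ℝ L] {a b c d : L}

theorem nonempty_lieEquiv_abelianLie (hdim : Module.finrank ℝ L = 4)
    (hv : LinearIndependent ℝ ![a, b, c, d]) (hab : ⁅a, b⁆ = 0) (hac : ⁅a, c⁆ = 0)
    (had : ⁅a, d⁆ = 0) (hbc : ⁅b, c⁆ = 0) (hbd : ⁅b, d⁆ = 0) (hcd : ⁅c, d⁆ = 0) :
    Nonempty (L ≃ₗ⁅ℝ⁆ AbelianLie 4) := by
  refine nonempty_lieEquiv_of_linearIndependent (by simp [hdim])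
    (show AbelianLie 4 ≃ₗ[ℝ] (Fin 4 → ℝ) from LinearEquiv.refl ℝ (Fin 4 → ℝ)) hv fun p q => ?_
  rw [lie_sum_fin_four]
  change _ = ∑ i, (0 : Fin 4 → ℝ) i • ![a, b, c, d] i
  simp [hab, hac, had, hbc, hbd, hcd]

theorem nonempty_lieEquiv_abelianLie_prod_heis3 (hdim : Module.finrank ℝ L = 4)
    (hv : LinearIndependent ℝ ![a, b, c, d]) (hab : ⁅a, b⁆ = 0) (hac : ⁅a, c⁆ = 0)
    (had : ⁅a, d⁆ = 0) (hbc : ⁅b, c⁆ = d) (hbd : ⁅b, d⁆ = 0) (hcd : ⁅c, d⁆ = 0) :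
    Nonempty (L ≃ₗ⁅ℝ⁆ (AbelianLie 1 × Heis3)) := by
  let φ : (AbelianLie 1 × Heis3) ≃ₗ[ℝ] (Fin 4 → ℝ) :=
    { toFun := fun p => ![p.1 0, p.2 0, p.2 1, p.2 2]
      map_add' := fun p q => by ext i; fin_cases i <;> rfl
      map_smul' := fun t p => by ext i; fin_cases i <;> rfl
      invFun := fun f => (![f 0], ![f 1, f 2, f 3])
      left_inv := fun p => Prod.ext (by funext i; fin_cases i; rfl)
        (by funext i; fin_cases i <;> rfl)
      right_inv := fun f => by ext i; fin_cases i <;> rfl }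
  have hφ : ∀ p, φ p = ![p.1 0, p.2 0, p.2 1, p.2 2] := fun _ => rfl
  refine nonempty_lieEquiv_of_linearIndependent (by simp [hdim]) φ hv fun p q => ?_
  have hpq : φ ⁅p, q⁆ = ![0, 0, 0, p.2 0 * q.2 1 - p.2 1 * q.2 0] := rfl
  rw [lie_sum_fin_four, hpq, hφ, hφ]
  simp [Fin.sum_univ_four, hab, hac, had, hbc, hbd, hcd]

theorem nonempty_lieEquiv_abelianLie_prod_aff (hdim : Module.finrank ℝ L = 4)
    (hv : LinearIndependent ℝ ![a, b, c, d]) (hab : ⁅a, b⁆ = 0) (hac : ⁅a, c⁆ = 0)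
    (had : ⁅a, d⁆ = 0) (hbc : ⁅b, c⁆ = 0) (hbd : ⁅b, d⁆ = 0) (hcd : ⁅c, d⁆ = d) :
    Nonempty (L ≃ₗ⁅ℝ⁆ (AbelianLie 2 × Aff ℝ)) := by
  let φ : (AbelianLie 2 × Aff ℝ) ≃ₗ[ℝ] (Fin 4 → ℝ) :=
    { toFun := fun p => ![p.1 0, p.1 1, p.2.1, p.2.2]
      map_add' := fun p q => by ext i; fin_cases i <;> rfl
      map_smul' := fun t p => by ext i; fin_cases i <;> rfl
      invFun := fun f => (![f 0, f 1], (f 2, f 3))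
      left_inv := fun p => Prod.ext (by funext i; fin_cases i <;> rfl) rfl
      right_inv := fun f => by ext i; fin_cases i <;> rfl }
  have hφ : ∀ p, φ p = ![p.1 0, p.1 1, p.2.1, p.2.2] := fun _ => rfl
  refine nonempty_lieEquiv_of_linearIndependent (by simp [hdim]) φ hv fun p q => ?_
  have hpq : φ ⁅p, q⁆ = ![0, 0, 0, p.2.1 * q.2.2 - q.2.1 * p.2.2] := rfl
  rw [lie_sum_fin_four, hpq, hφ, hφ]
  simp only [Fin.sum_univ_four, Matrix.cons_val, hab, hac, had, hbc, hbd, hcd]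
  module

theorem nonempty_lieEquiv_aff_prod_aff (hdim : Module.finrank ℝ L = 4)
    (hv : LinearIndependent ℝ ![a, b, c, d]) (hab : ⁅a, b⁆ = b) (hac : ⁅a, c⁆ = 0)
    (had : ⁅a, d⁆ = 0) (hbc : ⁅b, c⁆ = 0) (hbd : ⁅b, d⁆ = 0) (hcd : ⁅c, d⁆ = d) :
    Nonempty (L ≃ₗ⁅ℝ⁆ (Aff ℝ × Aff ℝ)) := by
  let φ : (Aff ℝ × Aff ℝ) ≃ₗ[ℝ] (Fin 4 → ℝ) :=
    { toFun := fun p => ![p.1.1, p.1.2, p.2.1, p.2.2]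
      map_add' := fun p q => by ext i; fin_cases i <;> rfl
      map_smul' := fun t p => by ext i; fin_cases i <;> rfl
      invFun := fun f => ((f 0, f 1), (f 2, f 3))
      left_inv := fun p => rfl
      right_inv := fun f => by ext i; fin_cases i <;> rfl }
  have hφ : ∀ p, φ p = ![p.1.1, p.1.2, p.2.1, p.2.2] := fun _ => rfl
  refine nonempty_lieEquiv_of_linearIndependent (by simp [hdim]) φ hv fun p q => ?_
  have hpq : φ ⁅p, q⁆ =
      ![0, p.1.1 * q.1.2 - q.1.1 * p.1.2, 0, p.2.1 * q.2.2 - q.2.1 * p.2.2] := rfl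
  rw [lie_sum_fin_four, hpq, hφ, hφ]
  simp only [Fin.sum_univ_four, Matrix.cons_val, hab, hac, had, hbc, hbd, hcd]
  module

theorem nonempty_lieEquiv_aff_complex (hdim : Module.finrank ℝ L = 4)
    (hv : LinearIndependent ℝ ![a, b, c, d]) (hab : ⁅a, b⁆ = 0) (hac : ⁅a, c⁆ = c)
    (had : ⁅a, d⁆ = d) (hbc : ⁅b, c⁆ = d) (hbd : ⁅b, d⁆ = -c) (hcd : ⁅c, d⁆ = 0) :
    Nonempty (L ≃ₗ⁅ℝ⁆ Aff ℂ) := by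
  let φ : Aff ℂ ≃ₗ[ℝ] (Fin 4 → ℝ) :=
    { toFun := fun p => ![p.1.re, p.1.im, p.2.re, p.2.im]
      map_add' := fun p q => by ext i; fin_cases i <;> rfl
      map_smul' := fun t p => by
        have hfst : (t • p).1 = t • p.1 := rfl
        have hsnd : (t • p).2 = t • p.2 := rfl
        ext i; fin_cases i <;> simp [hfst, hsnd]
      invFun := fun f => (⟨f 0, f 1⟩, ⟨f 2, f 3⟩)
      left_inv := fun p => rfl
      right_inv := fun f => by ext i; fin_cases i <;> rfl }
  have hφ : ∀ p, φ p = ![p.1.re, p.1.im, p.2.re, p.2.im] := fun _ => rfl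
  refine nonempty_lieEquiv_of_linearIndependent (by simp [hdim]) φ hv fun p q => ?_
  have hpq : φ ⁅p, q⁆ =
      ![0, 0, (p.1 * q.2 - q.1 * p.2).re, (p.1 * q.2 - q.1 * p.2).im] := rfl
  rw [lie_sum_fin_four, hpq, hφ, hφ]
  simp only [Fin.sum_univ_four, Matrix.cons_val, Complex.sub_re, Complex.sub_im, Complex.mul_re,
    Complex.mul_im, hab, hac, had, hbc, hbd, hcd]
  module

theorem nonempty_lieEquiv_lieR4 {α β : ℝ} (hdim : Module.finrank ℝ L = 4)
    (hv : LinearIndependent ℝ ![a, b, c, d]) (hab : ⁅a, b⁆ = 0) (hac : ⁅a, c⁆ = 0)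
    (hda : ⁅d, a⁆ = a) (hbc : ⁅b, c⁆ = 0) (hdb : ⁅d, b⁆ = α • b) (hdc : ⁅d, c⁆ = β • c) :
    Nonempty (L ≃ₗ⁅ℝ⁆ LieR4 α β) := by
  refine nonempty_lieEquiv_of_linearIndependent (by simp [hdim])
    (show LieR4 α β ≃ₗ[ℝ] (Fin 4 → ℝ) from LinearEquiv.refl ℝ (Fin 4 → ℝ)) hv fun p q => ?_
  rw [lie_sum_fin_four]
  change _ = ∑ i, LieR4.bracket α β p q i • ![a, b, c, d] i
  change (p 0 * q 1 - p 1 * q 0) • ⁅a, b⁆ + (p 0 * q 2 - p 2 * q 0) • ⁅a, c⁆ +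
      (p 0 * q 3 - p 3 * q 0) • ⁅a, d⁆ + (p 1 * q 2 - p 2 * q 1) • ⁅b, c⁆ +
      (p 1 * q 3 - p 3 * q 1) • ⁅b, d⁆ + (p 2 * q 3 - p 3 * q 2) • ⁅c, d⁆ = _
  rw [← lie_skew a d, ← lie_skew b d, ← lie_skew c d, hab, hac, hda, hbc, hdb, hdc]
  simp only [Fin.sum_univ_four, Matrix.cons_val, LieR4.bracket]
  module

theorem nonempty_lieEquiv_lieD4 {k t : ℝ} (hk : k ≠ 0) (hdim : Module.finrank ℝ L = 4)
    (hv : LinearIndependent ℝ ![a, b, c, d]) (hab : ⁅a, b⁆ = k • c) (hac : ⁅a, c⁆ = 0)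
    (hda : ⁅d, a⁆ = t • a) (hbc : ⁅b, c⁆ = 0) (hdb : ⁅d, b⁆ = (1 - t) • b) (hdc : ⁅d, c⁆ = c) :
    Nonempty (L ≃ₗ⁅ℝ⁆ LieD4 t) := by
  have hv' : LinearIndependent ℝ ![a, b, k • c, d] := by
    convert hv.units_smul ![1, 1, Units.mk0 k hk, 1] using 1
    ext i
    fin_cases i <;> simp
  refine nonempty_lieEquiv_of_linearIndependent (by simp [hdim])
    (show LieD4 t ≃ₗ[ℝ] (Fin 4 → ℝ) from LinearEquiv.refl ℝ (Fin 4 → ℝ)) hv' fun p q => ?_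
  rw [lie_sum_fin_four]
  change _ = ∑ i, LieD4.bracket t p q i • ![a, b, k • c, d] i
  change (p 0 * q 1 - p 1 * q 0) • ⁅a, b⁆ + (p 0 * q 2 - p 2 * q 0) • ⁅a, k • c⁆ +
      (p 0 * q 3 - p 3 * q 0) • ⁅a, d⁆ + (p 1 * q 2 - p 2 * q 1) • ⁅b, k • c⁆ +
      (p 1 * q 3 - p 3 * q 1) • ⁅b, d⁆ + (p 2 * q 3 - p 3 * q 2) • ⁅k • c, d⁆ = _
  rw [← lie_skew a d, ← lie_skew b d, ← lie_skew (k • c) d, lie_smul, lie_smul, lie_smul, hab,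
    hac, hda, hbc, hdb, hdc]
  simp only [Fin.sum_univ_four, Matrix.cons_val, LieD4.bracket]
  module

end Models

/-- The multiplication table of an algebra on two linearly independent elements `x`, `y`:
`x * x = a`, `x * y = b`, `y * x = c` and `y * y = d`. Spanning is left to the dimension. -/
structure IsMulTable (K : Type*) {A : Type*} [Field K] [NonUnitalNonAssocRing A] [Module K A]
    (x y a b c d : A) : Prop where
  linearIndependent : LinearIndependent K ![x, y]
  mul_self_left : x * x = a
  mul_left_right : x * y = b
  mul_right_left : y * x = c
  mul_self_right : y * y = d

section Plane

variable {K V : Type*} [Field K] [AddCommGroup V] [Module K V]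

theorem exists_eq_smul_add_smul (hdim : Module.finrank K V = 2) {x y : V}
    (hxy : LinearIndependent K ![x, y]) (z : V) : ∃ a b : K, z = a • x + b • y := by
  have : Module.Finite K V := Module.finite_of_finrank_eq_succ hdim
  have hspan := hxy.span_eq_top_of_card_eq_finrank' (by simp [hdim])
  have hz : z ∈ Submodule.span K (Set.range ![x, y]) := hspan ▸ Submodule.mem_top
  rw [Matrix.range_cons_cons_empty, Submodule.mem_span_pair] at hz
  obtain ⟨a, b, hab⟩ := hz
  exact ⟨a, b, hab.symm⟩

theorem exists_linearIndependent_pair_of_ne_zero (hdim : Module.finrank K V = 2) {x : V}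
    (hx : x ≠ 0) : ∃ y, LinearIndependent K ![x, y] :=
  have : Module.Finite K V := Module.finite_of_finrank_eq_succ hdim
  exists_linearIndependent_pair_of_one_lt_finrank (by omega) hx

end Plane

section NonUnitalCommRing

variable {K A : Type*} [Field K] [NonUnitalCommRing A] [Module K A] [IsScalarTower K A A]
  [SMulCommClass K A A]

theorem exists_isIdempotentElem_of_mul_self_eq_smul {x : A} {c : K} (hx : x ≠ 0) (hc : c ≠ 0)
    (h : x * x = c • x) : ∃ u : A, u ≠ 0 ∧ IsIdempotentElem u := by
  refine ⟨c⁻¹ • x, smul_ne_zero (inv_ne_zero hc) hx, ?_⟩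
  rw [IsIdempotentElem, smul_mul_smul_comm, h, smul_smul, inv_mul_cancel_right₀ hc]

theorem exists_isIdempotentElem_of_mul_mul_self_eq {x : A} {a b : K} (hx : x ≠ 0) (ha : a ≠ 0)
    (h : x * (x * x) = a • x + b • (x * x)) : ∃ u : A, u ≠ 0 ∧ IsIdempotentElem u := by
  have hux : a⁻¹ • (x * x - b • x) * x = x := by
    rw [smul_mul_assoc, sub_mul, smul_mul_assoc, mul_assoc, h, add_sub_cancel_right,
      inv_smul_smul₀ ha]
  refine ⟨a⁻¹ • (x * x - b • x), fun hu => hx ?_, ?_⟩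
  · rw [← hux, hu, zero_mul]
  · rw [IsIdempotentElem, mul_smul_comm, mul_sub, mul_smul_comm, ← mul_assoc, hux]

theorem mul_self_eq_zero_of_not_linearIndependent
    (hA : ∀ u : A, IsIdempotentElem u → u = 0) {x : A}
    (h : ¬ LinearIndependent K ![x, x * x]) : x * x = 0 := by
  by_cases hx : x = 0
  · rw [hx, zero_mul]
  rw [LinearIndependent.pair_iff' hx] at h
  push Not at h
  obtain ⟨c, hc⟩ := h
  by_cases hc₀ : c = 0
  · rw [← hc, hc₀, zero_smul]
  · obtain ⟨u, hu, huu⟩ := exists_isIdempotentElem_of_mul_self_eq_smul hx hc₀ hc.symm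
    exact absurd (hA u huu) hu

theorem mul_mul_self_eq_zero_of_linearIndependent (hdim : Module.finrank K A = 2)
    (hA : ∀ u : A, IsIdempotentElem u → u = 0) {x : A}
    (h : LinearIndependent K ![x, x * x]) : x * (x * x) = 0 := by
  obtain ⟨a, b, hab⟩ := exists_eq_smul_add_smul hdim h (x * (x * x))
  have ha : a = 0 := by
    by_contra ha
    obtain ⟨u, hu, huu⟩ := exists_isIdempotentElem_of_mul_mul_self_eq (h.ne_zero 0) ha hab
    exact hu (hA u huu)
  rw [ha, zero_smul, zero_add] at hab
  have hsq : x * x * (x * x) = (b * b) • (x * x) := by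
    rw [mul_assoc, hab, mul_smul_comm, hab, smul_smul]
  have hb : b = 0 := by
    by_contra hb
    obtain ⟨u, hu, huu⟩ := exists_isIdempotentElem_of_mul_self_eq_smul (h.ne_zero 1)
      (mul_ne_zero hb hb) hsq
    exact hu (hA u huu)
  rw [hab, hb, zero_smul]

omit [IsScalarTower K A A] [SMulCommClass K A A] in
theorem mul_eq_zero_of_forall_mul_self_eq_zero [NeZero (2 : K)] (h : ∀ x : A, x * x = 0)
    (x y : A) : x * y = 0 := by
  have hxy := h (x + y)
  rw [add_mul, mul_add, mul_add, h, h, mul_comm y x, zero_add, add_zero, ← two_smul K] at hxy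
  exact (smul_eq_zero.1 hxy).resolve_left two_ne_zero

theorem exists_isMulTable_of_forall_isIdempotentElem_eq_zero [NeZero (2 : K)]
    (hdim : Module.finrank K A = 2) (hA : ∀ u : A, IsIdempotentElem u → u = 0) :
    (∃ x y : A, IsMulTable K x y 0 0 0 0) ∨ ∃ x y : A, IsMulTable K x y y 0 0 0 := by
  by_cases h : ∃ x : A, LinearIndependent K ![x, x * x]
  · obtain ⟨x, hx⟩ := h
    have hcube := mul_mul_self_eq_zero_of_linearIndependent hdim hA hx
    exact .inr ⟨x, x * x, hx, rfl, hcube, by rw [mul_comm, hcube],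
      by rw [mul_assoc, hcube, mul_zero]⟩
  · push Not at h
    have hmul : ∀ x y : A, x * y = 0 := mul_eq_zero_of_forall_mul_self_eq_zero (K := K)
      fun x => mul_self_eq_zero_of_not_linearIndependent hA (h x)
    have : Nontrivial A := Module.nontrivial_of_finrank_pos (R := K) (by omega)
    obtain ⟨x, hx⟩ := exists_ne (0 : A)
    obtain ⟨y, hxy⟩ := exists_linearIndependent_pair_of_ne_zero hdim hx
    exact .inl ⟨x, y, hxy, hmul _ _, hmul _ _, hmul _ _, hmul _ _⟩

omit [IsScalarTower K A A] in
theorem linearIndependent_pair_of_isIdempotentElem {e z : A} (he : IsIdempotentElem e)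
    (he₀ : e ≠ 0) (hz : z ≠ 0) (hez : e * z = 0) : LinearIndependent K ![e, z] := by
  rw [LinearIndependent.pair_iff' he₀]
  rintro a rfl
  rw [mul_smul_comm, he.eq] at hez
  exact hz hez

theorem exists_isMulTable_of_isIdempotentElem_of_mul_eq_zero (hdim : Module.finrank K A = 2)
    {e z : A} (he : IsIdempotentElem e) (he₀ : e ≠ 0) (hz : z ≠ 0) (hez : e * z = 0) :
    (∃ x y : A, IsMulTable K x y x 0 0 0) ∨ ∃ x y : A, IsMulTable K x y x 0 0 y := by
  have hli := linearIndependent_pair_of_isIdempotentElem (K := K) he he₀ hz hez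
  have hze : z * e = 0 := by rw [mul_comm, hez]
  obtain ⟨a, b, hzz⟩ := exists_eq_smul_add_smul hdim hli (z * z)
  have ha : a • e = 0 := by
    have := congrArg (e * ·) hzz
    simpa only [← mul_assoc, hez, zero_mul, mul_add, mul_smul_comm, he.eq, smul_zero, add_zero]
      using this.symm
  rw [ha, zero_add] at hzz
  by_cases hb : b = 0
  · exact .inl ⟨e, z, hli, he, hez, hze, by rw [hzz, hb, zero_smul]⟩
  · refine .inr ⟨e, b⁻¹ • z, linearIndependent_pair_of_isIdempotentElem he he₀
      (smul_ne_zero (inv_ne_zero hb) hz) ?_, he, ?_, ?_, ?_⟩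
    · rw [mul_smul_comm, hez, smul_zero]
    · rw [mul_smul_comm, hez, smul_zero]
    · rw [smul_mul_assoc, hze, smul_zero]
    · rw [smul_mul_smul_comm, hzz, smul_smul, inv_mul_cancel_right₀ hb]

theorem exists_mul_self_eq_smul_of_forall_mul_eq [NeZero (2 : K)] (hdim : Module.finrank K A = 2)
    {e : A} (he₀ : e ≠ 0) (he : ∀ z, e * z = z) :
    ∃ (y : A) (k : K), LinearIndependent K ![e, y] ∧ y * y = k • e := by
  obtain ⟨y, hey⟩ := exists_linearIndependent_pair_of_ne_zero hdim he₀
  obtain ⟨a, b, hyy⟩ := exists_eq_smul_add_smul hdim hey (y * y)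
  have hli : LinearIndependent K ![(1 : K) • e + (0 : K) • y, (-(b / 2)) • e + (1 : K) • y] :=
    (LinearIndependent.pair_add_smul_add_smul_iff ..).2 ⟨hey, by simp⟩
  refine ⟨(-(b / 2)) • e + y, a + b ^ 2 / 4, by simpa using hli, ?_⟩
  have h2 : (2 : K) ≠ 0 := two_ne_zero
  have h4 : (4 : K) ≠ 0 := by rw [show (4 : K) = 2 * 2 by norm_num]; exact mul_ne_zero h2 h2
  simp only [add_mul, mul_add, smul_mul_assoc, mul_smul_comm, he, mul_comm y e, hyy]
  match_scalars <;> field_simp <;> ring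

theorem exists_isMulTable_of_mul_self_eq_sq_smul [NeZero (2 : K)] {e y : A}
    (he : ∀ z, e * z = z) (hey : LinearIndependent K ![e, y]) {s : K} (hs : s ≠ 0)
    (hyy : y * y = (s * s) • e) : ∃ x y : A, IsMulTable K x y x 0 0 y := by
  have h2 : (2 : K) ≠ 0 := two_ne_zero
  have hli : LinearIndependent K
      ![(2 : K)⁻¹ • e + (2 * s)⁻¹ • y, (2 : K)⁻¹ • e + (-(2 * s)⁻¹) • y] := by
    refine (LinearIndependent.pair_add_smul_add_smul_iff ..).2 ⟨hey, fun h => ?_⟩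
    field_simp at h
    exact h2 (by linear_combination -h)
  refine ⟨_, _, hli, ?_, ?_, ?_, ?_⟩ <;>
    simp only [add_mul, mul_add, smul_mul_assoc, mul_smul_comm, he, mul_comm y e, hyy] <;>
    match_scalars <;> field_simp <;> ring

theorem exists_isMulTable_of_mul_self_eq_neg_sq_smul {e y : A} (he : ∀ z, e * z = z)
    (hey : LinearIndependent K ![e, y]) {s : K} (hs : s ≠ 0) (hyy : y * y = (-(s * s)) • e) :
    ∃ x y : A, IsMulTable K x y x y y (-x) := by
  have hli : LinearIndependent K ![(1 : K) • e, s⁻¹ • y] :=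
    (LinearIndependent.pair_smul_smul_iff isUnit_one (inv_ne_zero hs).isUnit).2 hey
  rw [one_smul] at hli
  refine ⟨e, s⁻¹ • y, hli, he e, he _, ?_, ?_⟩
  · rw [mul_comm, he]
  · rw [smul_mul_smul_comm, hyy, smul_smul, ← neg_one_smul K e]
    congr 1
    field_simp

end NonUnitalCommRing

section Real

variable {A : Type*} [NonUnitalCommRing A] [Module ℝ A] [IsScalarTower ℝ A A]
  [SMulCommClass ℝ A A]

theorem exists_isMulTable_of_forall_mul_eq (hdim : Module.finrank ℝ A = 2) {e : A} (he₀ : e ≠ 0)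
    (he : ∀ z, e * z = z) :
    (∃ x y : A, IsMulTable ℝ x y x 0 0 y) ∨ (∃ x y : A, IsMulTable ℝ x y x y y (-x)) ∨
      ∃ x y : A, IsMulTable ℝ x y x y y 0 := by
  obtain ⟨y, k, hey, hyy⟩ := exists_mul_self_eq_smul_of_forall_mul_eq hdim he₀ he
  rcases lt_trichotomy k 0 with hk | rfl | hk
  · refine .inr (.inl (exists_isMulTable_of_mul_self_eq_neg_sq_smul he hey
      (Real.sqrt_ne_zero'.2 (neg_pos.2 hk)) ?_))
    rw [hyy, Real.mul_self_sqrt (neg_pos.2 hk).le, neg_neg]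
  · exact .inr (.inr ⟨e, y, hey, he e, he y, by rw [mul_comm, he], by rw [hyy, zero_smul]⟩)
  · refine .inl (exists_isMulTable_of_mul_self_eq_sq_smul he hey (Real.sqrt_ne_zero'.2 hk) ?_)
    rw [hyy, Real.mul_self_sqrt hk.le]

theorem exists_isMulTable_of_nonUnitalCommRing (hdim : Module.finrank ℝ A = 2) :
    (∃ x y : A, IsMulTable ℝ x y 0 0 0 0) ∨ (∃ x y : A, IsMulTable ℝ x y y 0 0 0) ∨
      (∃ x y : A, IsMulTable ℝ x y x 0 0 0) ∨ (∃ x y : A, IsMulTable ℝ x y x 0 0 y) ∨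
      (∃ x y : A, IsMulTable ℝ x y x y y (-x)) ∨ ∃ x y : A, IsMulTable ℝ x y x y y 0 := by
  by_cases hnil : ∀ u : A, IsIdempotentElem u → u = 0
  · exact (exists_isMulTable_of_forall_isIdempotentElem_eq_zero hdim hnil).imp_right .inl
  push Not at hnil
  obtain ⟨e, he, he₀⟩ := hnil
  by_cases hann : ∀ z, e * z = 0 → z = 0
  · have hunit : ∀ z, e * z = z := fun z =>
      sub_eq_zero.1 (hann _ (by rw [mul_sub, ← mul_assoc, he.eq, sub_self]))
    exact .inr (.inr (.inr (exists_isMulTable_of_forall_mul_eq hdim he₀ hunit)))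
  · push Not at hann
    obtain ⟨z, hez, hz⟩ := hann
    exact .inr (.inr ((exists_isMulTable_of_isIdempotentElem_of_mul_eq_zero hdim he he₀ hz
      hez).imp_right .inl))

end Real

theorem linearIndependent_pair_of_lie_ne_zero {K L : Type*} [Field K] [LieRing L] [LieAlgebra K L]
    {x y : L} (h : ⁅x, y⁆ ≠ 0) : LinearIndependent K ![x, y] := by
  have hx : x ≠ 0 := by
    rintro rfl
    exact h (zero_lie y)
  rw [LinearIndependent.pair_iff' hx]
  rintro a rfl
  exact h (by rw [lie_smul, lie_self, smul_zero])

section LieAlgebra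

variable {K : Type*} [Field K]

theorem exists_lie_eq_self_of_finrank_eq_two {L : Type*} [LieRing L] [LieAlgebra K L]
    (hdim : Module.finrank K L = 2) (hL : ¬ IsLieAbelian L) :
    ∃ x y : L, y ≠ 0 ∧ ⁅x, y⁆ = y := by
  obtain ⟨u, v, huv⟩ : ∃ u v : L, ⁅u, v⁆ ≠ 0 := by
    by_contra! h
    exact hL ⟨h⟩
  obtain ⟨a, b, hab⟩ := exists_eq_smul_add_smul hdim
    (linearIndependent_pair_of_lie_ne_zero (K := K) huv) ⁅u, v⁆
  have hu : ⁅u, ⁅u, v⁆⁆ = b • ⁅u, v⁆ := by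
    conv_lhs => rw [hab, lie_add, lie_smul, lie_smul, lie_self, smul_zero, zero_add]
  have hv : ⁅v, ⁅u, v⁆⁆ = (-a) • ⁅u, v⁆ := by
    conv_lhs => rw [hab, lie_add, lie_smul, lie_smul, lie_self, smul_zero, add_zero, ← lie_skew]
    rw [smul_neg, neg_smul]
  by_cases hb : b = 0
  · have ha : -a ≠ 0 := fun ha => huv (by rw [hab, hb, neg_eq_zero.1 ha, zero_smul, zero_smul,
      zero_add])
    exact ⟨(-a)⁻¹ • v, ⁅u, v⁆, huv, by rw [smul_lie, hv, inv_smul_smul₀ ha]⟩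
  · exact ⟨b⁻¹ • u, ⁅u, v⁆, huv, by rw [smul_lie, hu, inv_smul_smul₀ hb]⟩

theorem lie_pow_eq_nsmul {E : Type*} [Ring E] {f g : E} (h : ⁅g, f⁆ = f) (n : ℕ) :
    ⁅g, f ^ n⁆ = n • f ^ n := by
  induction n with
  | zero => simp [Ring.lie_def]
  | succ n ih =>
    have hleibniz : ⁅g, f ^ n * f⁆ = ⁅g, f ^ n⁆ * f + f ^ n * ⁅g, f⁆ := by
      simp only [Ring.lie_def]
      noncomm_ring
    rw [pow_succ, hleibniz, ih, h, smul_mul_assoc, succ_nsmul]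

theorem isNilpotent_of_lie_eq_self [CharZero K] {E : Type*} [Ring E] [Algebra K E]
    [FiniteDimensional K E] {f g : E} (h : ⁅g, f⁆ = f) : IsNilpotent f := by
  -- otherwise every natural number is an eigenvalue of `⁅g, ·⁆`, with eigenvector `f ^ n`
  by_contra hf
  let adg : Module.End K E := LinearMap.mulLeft K g - LinearMap.mulRight K g
  have heigen : ∀ n : ℕ, adg.HasEigenvalue (n : K) := fun n => by
    refine Module.End.hasEigenvalue_of_hasEigenvector (x := f ^ n)
      ⟨Module.End.mem_eigenspace_iff.2 ?_, fun h => hf ⟨n, h⟩⟩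
    rw [Nat.cast_smul_eq_nsmul, ← lie_pow_eq_nsmul h]
    rfl
  exact (Set.infinite_range_of_injective Nat.cast_injective).mono
    (Set.range_subset_iff.2 heigen) adg.finite_hasEigenvalue

end LieAlgebra

section LeftPreLie

variable {K A : Type*} [Field K] [LeftPreLieRing A] [LeftPreLieAlgebra K A]

theorem lie_mul_eq (x y z : A) : ⁅x, y⁆ * z = x * (y * z) - y * (x * z) := by
  have h := LeftPreLieRing.assoc_symm x y z
  rw [associator_apply, associator_apply, sub_eq_sub_iff_sub_eq_sub] at h
  rw [Ring.lie_def, sub_mul, h]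

theorem mul_mul_eq_zero_of_lie_eq_self [CharZero K] (hdim : Module.finrank K A = 2) {x y : A}
    (h : ⁅x, y⁆ = y) (z : A) : y * (y * z) = 0 := by
  have : FiniteDimensional K A := Module.finite_of_finrank_eq_succ hdim
  have hlie : ⁅LinearMap.mulLeft K x, LinearMap.mulLeft K y⁆ = LinearMap.mulLeft K y := by
    ext z
    simp only [Ring.lie_def, LinearMap.sub_apply, Module.End.mul_apply, LinearMap.mulLeft_apply]
    rw [← lie_mul_eq, h]
  have hnil := (isNilpotent_of_lie_eq_self (K := K) hlie).charpoly_eq_X_pow_finrank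
  have hsq := (LinearMap.mulLeft K y).aeval_self_charpoly
  rw [hnil, hdim, map_pow, Polynomial.aeval_X] at hsq
  simpa [pow_two] using LinearMap.congr_fun hsq z

theorem exists_isMulTable_of_mul_self_ne_zero [CharZero K] (hdim : Module.finrank K A = 2)
    {x y : A} (hxy : ⁅x, y⁆ = y) (hyy : y * y ≠ 0) :
    ∃ k : K, k ≠ 0 ∧ ∃ x y : A, IsMulTable K x y x ((1 / 2 : K) • y) 0 (k • x) := by
  have hnil := mul_mul_eq_zero_of_lie_eq_self hdim hxy y
  have hli : LinearIndependent K ![x, y] :=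
    linearIndependent_pair_of_lie_ne_zero fun h => hyy (by rw [← hxy, h, mul_zero])
  obtain ⟨p, q, hpq⟩ := exists_eq_smul_add_smul hdim hli (y * y)
  have hp : p ≠ 0 := by
    rintro rfl
    rw [zero_smul, zero_add] at hpq
    rw [hpq, mul_smul_comm] at hnil
    rcases smul_eq_zero.1 hnil with rfl | h
    · exact hyy (by rw [hpq, zero_smul])
    · exact hyy h
  obtain ⟨u, hyu⟩ : ∃ u, y * y = p • u := ⟨p⁻¹ • (y * y), (smul_inv_smul₀ hp _).symm⟩
  have hyu₀ : y * u = 0 := by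
    rw [hyu, mul_smul_comm] at hnil
    exact (smul_eq_zero.1 hnil).resolve_left hp
  have hlie : ⁅u, y⁆ = y := by
    refine smul_right_injective A hp ?_
    simp only [← smul_lie, ← hyu]
    rw [hpq, add_lie, smul_lie, smul_lie, hxy, lie_self, smul_zero, add_zero]
  have huy : u * y = y := by rwa [Ring.lie_def, hyu₀, sub_zero] at hlie
  have huu : u * u = (2 : K) • u := by
    have h := lie_mul_eq u y y
    rw [hlie, huy, hyu, mul_smul_comm, eq_sub_iff_add_eq, ← smul_add] at h
    rw [← smul_right_injective A hp h, two_smul]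
  refine ⟨2 * p, by simpa using hp, (1 / 2 : K) • u, y,
    linearIndependent_pair_of_lie_ne_zero ?_, ?_, ?_, ?_, ?_⟩
  · rw [smul_lie, hlie]
    exact smul_ne_zero (by norm_num) fun h => hyy (by rw [h, zero_mul])
  · rw [smul_mul_smul_comm, huu, smul_smul]
    norm_num
  · rw [smul_mul_assoc, huy]
  · rw [mul_smul_comm, hyu₀, smul_zero]
  · rw [hyu, smul_smul, mul_one_div, mul_div_cancel_left₀ p two_ne_zero]

theorem exists_isMulTable_of_mul_self_eq_zero [CharZero K] (hdim : Module.finrank K A = 2)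
    {x y : A} (hxy : ⁅x, y⁆ = y) (hy : y ≠ 0) (hyy : y * y = 0) :
    ∃ a b c : K, IsMulTable K x y (a • x + b • y) ((c + 1) • y) (c • y) 0 ∧ (c = 0 ∨ a = c) := by
  have hli : LinearIndependent K ![x, y] := linearIndependent_pair_of_lie_ne_zero (by rwa [hxy])
  obtain ⟨a, b, hxx⟩ := exists_eq_smul_add_smul hdim hli (x * x)
  obtain ⟨c, hyx⟩ : ∃ c : K, y * x = c • y := by
    obtain ⟨r, c, hrc⟩ := exists_eq_smul_add_smul hdim hli (y * x)
    have hnil := mul_mul_eq_zero_of_lie_eq_self hdim hxy x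
    rw [hrc, mul_add, mul_smul_comm, mul_smul_comm, hyy, smul_zero, add_zero] at hnil
    rcases smul_eq_zero.1 hnil with rfl | h
    · exact ⟨c, by rw [hrc, zero_smul, zero_add]⟩
    · exact ⟨0, by rw [h, zero_smul]⟩
  have hxy' : x * y = (c + 1) • y := by
    rw [Ring.lie_def, sub_eq_iff_eq_add, hyx] at hxy
    rw [hxy]
    module
  refine ⟨a, b, c, ⟨hli, hxx, hxy', hyx, hyy⟩, ?_⟩
  have h := lie_mul_eq x y x
  simp only [hxy, hyx, hxx, mul_add, mul_smul_comm, hxy', hyy] at h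
  have h' : (c * (c - a)) • y = 0 := by
    rw [smul_zero, add_zero] at h
    linear_combination (norm := module) -h
  rcases mul_eq_zero.1 ((smul_eq_zero.1 h').resolve_right hy) with h | h
  · exact .inl h
  · exact .inr (sub_eq_zero.1 h).symm

/-- A Hessian metric on a left-symmetric algebra: a non-degenerate symmetric bilinear form, of any
signature, which satisfies the Codazzi equation for the flat connection given by the left
multiplications. -/
structure IsHessianMetric (g : LinearMap.BilinForm K A) : Prop where
  isSymm : g.IsSymm
  nondegenerate : g.Nondegenerate
  codazzi : ∀ x y z, g ⁅x, y⁆ z = g x (y * z) - g y (x * z)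

namespace IsHessianMetric

variable {g : LinearMap.BilinForm K A}

theorem apply_ne_zero_of_apply_self_eq_zero (hg : IsHessianMetric g)
    (hdim : Module.finrank K A = 2) {x y : A} (hxy : LinearIndependent K ![x, y])
    (hyy : g y y = 0) : g y x ≠ 0 := by
  intro hyx
  refine hxy.ne_zero 1 (hg.nondegenerate.1 y fun z => ?_)
  obtain ⟨a, b, rfl⟩ := exists_eq_smul_add_smul hdim hxy z
  simp [hyx, hyy]

theorem exists_isMulTable_neg [NeZero (2 : K)] (hg : IsHessianMetric g)
    (hdim : Module.finrank K A = 2) {x y : A} {a b : K}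
    (h : IsMulTable K x y (a • x + b • y) y 0 0) : ∃ x y : A, IsMulTable K x y x (-y) 0 0 := by
  have hlie : ⁅x, y⁆ = y := by rw [Ring.lie_def, h.mul_left_right, h.mul_right_left, sub_zero]
  have hyy : g y y = 0 := by
    have := hg.codazzi x y y
    rw [hlie, h.mul_self_right, h.mul_left_right, map_zero, zero_sub] at this
    have htwo : 2 * g y y = 0 := by linear_combination this
    exact (mul_eq_zero.1 htwo).resolve_left two_ne_zero
  have ha : a = -1 := by
    have := hg.codazzi x y x
    rw [hlie, h.mul_right_left, h.mul_self_left, map_zero, map_add, map_smul, map_smul, hyy,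
      smul_zero, smul_eq_mul] at this
    have hyx := hg.apply_ne_zero_of_apply_self_eq_zero hdim h.linearIndependent hyy
    refine mul_right_cancel₀ hyx ?_
    linear_combination this
  subst ha
  obtain ⟨d, rfl⟩ : ∃ d, b = 2 * d := ⟨b / 2, (mul_div_cancel₀ b two_ne_zero).symm⟩
  have hli : LinearIndependent K ![(-1 : K) • x + d • y, (0 : K) • x + (1 : K) • y] :=
    (LinearIndependent.pair_add_smul_add_smul_iff ..).2 ⟨h.linearIndependent, by simp⟩
  refine ⟨_, _, hli, ?_, ?_, ?_, ?_⟩ <;>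
    simp only [add_mul, mul_add, smul_mul_assoc, mul_smul_comm, h.mul_self_left, h.mul_left_right,
      h.mul_right_left, h.mul_self_right] <;>
    module

theorem exists_isMulTable_two_smul (hg : IsHessianMetric g)
    (hdim : Module.finrank K A = 2) {x y : A} {b c : K}
    (h : IsMulTable K x y (c • x + b • y) ((c + 1) • y) (c • y) 0) :
    ∃ x y : A, IsMulTable K x y ((2 : K) • x) y ((2 : K) • y) 0 := by
  have hlie : ⁅x, y⁆ = y := by rw [Ring.lie_def, h.mul_left_right, h.mul_right_left]; module
  have hyx : g y x = -b * g y y := by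
    have := hg.codazzi x y x
    rw [hlie, h.mul_right_left, h.mul_self_left] at this
    simp only [map_add, map_smul, smul_eq_mul, hg.isSymm.eq x y] at this
    linear_combination this
  have hyy : g y y ≠ 0 := fun hyy =>
    hg.apply_ne_zero_of_apply_self_eq_zero hdim h.linearIndependent hyy (by rw [hyx, hyy, mul_zero])
  have hc : c = -2 := by
    have := hg.codazzi x y y
    rw [hlie, h.mul_self_right, h.mul_left_right, map_zero, map_smul, smul_eq_mul] at this
    refine mul_right_cancel₀ hyy ?_
    linear_combination this
  subst hc
  have hli : LinearIndependent K ![(-1 : K) • x + (-b) • y, (0 : K) • x + (1 : K) • y] :=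
    (LinearIndependent.pair_add_smul_add_smul_iff ..).2 ⟨h.linearIndependent, by simp⟩
  refine ⟨_, _, hli, ?_, ?_, ?_, ?_⟩ <;>
    simp only [add_mul, mul_add, smul_mul_assoc, mul_smul_comm, h.mul_self_left, h.mul_left_right,
      h.mul_right_left, h.mul_self_right] <;>
    module

theorem exists_isMulTable [CharZero K] (hg : IsHessianMetric g)
    (hdim : Module.finrank K A = 2) (hA : ¬ IsLieAbelian A) :
    (∃ x y : A, IsMulTable K x y x (-y) 0 0) ∨
      (∃ x y : A, IsMulTable K x y ((2 : K) • x) y ((2 : K) • y) 0) ∨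
      ∃ k : K, k ≠ 0 ∧ ∃ x y : A, IsMulTable K x y x ((1 / 2 : K) • y) 0 (k • x) := by
  obtain ⟨x, y, hy, hlie⟩ := exists_lie_eq_self_of_finrank_eq_two hdim hA
  by_cases hyy : y * y = 0
  · obtain ⟨a, b, c, h, hc | rfl⟩ := exists_isMulTable_of_mul_self_eq_zero hdim hlie hy hyy
    · rw [hc, zero_add, one_smul, zero_smul] at h
      exact .inl (hg.exists_isMulTable_neg hdim h)
    · exact .inr (.inl (hg.exists_isMulTable_two_smul hdim h))
  · exact .inr (.inr (exists_isMulTable_of_mul_self_ne_zero hdim hlie hyy))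

end IsHessianMetric

end LeftPreLie

theorem exists_isMulTable_of_isLieAbelian {A : Type*} [LeftPreLieRing A] [LeftPreLieAlgebra ℝ A]
    (hdim : Module.finrank ℝ A = 2) (hA : IsLieAbelian A) :
    (∃ x y : A, IsMulTable ℝ x y 0 0 0 0) ∨ (∃ x y : A, IsMulTable ℝ x y y 0 0 0) ∨
      (∃ x y : A, IsMulTable ℝ x y x 0 0 0) ∨ (∃ x y : A, IsMulTable ℝ x y x 0 0 y) ∨
      (∃ x y : A, IsMulTable ℝ x y x y y (-x)) ∨ ∃ x y : A, IsMulTable ℝ x y x y y 0 := by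
  have hcomm : ∀ x y : A, x * y = y * x := fun x y => commute_iff_lie_eq.2 (hA.trivial x y)
  have hassoc : ∀ x y z : A, x * y * z = x * (y * z) := fun x y z => by
    have h := lie_mul_eq x z y
    rw [hA.trivial, zero_mul, eq_comm, sub_eq_zero] at h
    rw [hcomm y z, h, hcomm z]
  let _ : NonUnitalCommRing A :=
    { (inferInstance : NonUnitalNonAssocRing A) with mul_comm := hcomm, mul_assoc := hassoc }
  exact exists_isMulTable_of_nonUnitalCommRing hdim

/-- `e` and `j` present the Lie algebra `L` as the semidirect product of the Lie algebra of a
left-symmetric algebra `A`, embedded by `j`, with the abelian Lie algebra on the vector space `A`,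
embedded by `e`, on which it acts by left multiplication. -/
structure IsLeftMulSemidirect {R A L : Type*} [CommRing R] [LeftPreLieRing A]
    [LeftPreLieAlgebra R A] [LieRing L] [LieAlgebra R L] (e j : A →ₗ[R] L) : Prop where
  bijective : Function.Bijective (e.coprod j)
  lie_left : ∀ x y, ⁅e x, e y⁆ = 0
  lie_right_left : ∀ x y, ⁅j x, e y⁆ = e (x * y)
  lie_right : ∀ x y, ⁅j x, j y⁆ = j ⁅x, y⁆

namespace IsLeftMulSemidirect

section Field

variable {K A L : Type*} [Field K] [LeftPreLieRing A] [LeftPreLieAlgebra K A] [LieRing L]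
  [LieAlgebra K L] {e j : A →ₗ[K] L}

theorem two_mul_finrank [FiniteDimensional K L] (h : IsLeftMulSemidirect e j) :
    2 * Module.finrank K A = Module.finrank K L := by
  have he : Function.Injective e := fun x y hxy =>
    congrArg Prod.fst (h.bijective.1 (show e.coprod j (x, 0) = e.coprod j (y, 0) by simp [hxy]))
  have : FiniteDimensional K A := Module.Finite.of_injective e he
  rw [← (LinearEquiv.ofBijective _ h.bijective).finrank_eq, Module.finrank_prod, two_mul]

theorem lie_left_right (h : IsLeftMulSemidirect e j) (x y : A) : ⁅e x, j y⁆ = -e (y * x) := by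
  rw [← lie_skew, h.lie_right_left]

theorem linearIndependent (h : IsLeftMulSemidirect e j) {x y : A}
    (hxy : LinearIndependent K ![x, y]) : LinearIndependent K ![e x, e y, j x, j y] := by
  rw [LinearIndependent.pair_iff] at hxy
  rw [Fintype.linearIndependent_iff]
  intro t ht
  have ht' : e.coprod j (t 0 • x + t 1 • y, t 2 • x + t 3 • y) = e.coprod j 0 := by
    rw [map_zero, ← ht]
    simp [Fin.sum_univ_four, add_assoc]
  obtain ⟨h₀, h₁⟩ := Prod.ext_iff.1 (h.bijective.1 ht')
  obtain ⟨h0, h1⟩ := hxy _ _ h₀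
  obtain ⟨h2, h3⟩ := hxy _ _ h₁
  exact Fin.forall_fin_succ.2 ⟨h0, Fin.forall_fin_succ.2 ⟨h1, Fin.forall_fin_two.2 ⟨h2, h3⟩⟩⟩

end Field

section Real

variable {A L : Type*} [LeftPreLieRing A] [LeftPreLieAlgebra ℝ A] [LieRing L] [LieAlgebra ℝ L]
  {e j : A →ₗ[ℝ] L} {x y : A}

theorem nonempty_lieEquiv_abelianLie (h : IsLeftMulSemidirect e j)
    (hdim : Module.finrank ℝ L = 4) (t : IsMulTable ℝ x y 0 0 0 0) :
    Nonempty (L ≃ₗ⁅ℝ⁆ AbelianLie 4) := by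
  refine _root_.nonempty_lieEquiv_abelianLie hdim
    (h.linearIndependent t.linearIndependent) ?_ ?_ ?_ ?_ ?_ ?_ <;>
  simp [h.lie_left, h.lie_left_right, h.lie_right, Ring.lie_def, t.mul_self_left, t.mul_left_right,
    t.mul_right_left, t.mul_self_right]

theorem nonempty_lieEquiv_abelianLie_prod_heis3 (h : IsLeftMulSemidirect e j)
    (hdim : Module.finrank ℝ L = 4) (t : IsMulTable ℝ x y y 0 0 0) :
    Nonempty (L ≃ₗ⁅ℝ⁆ (AbelianLie 1 × Heis3)) := by
  refine _root_.nonempty_lieEquiv_abelianLie_prod_heis3 hdim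
    (linearIndependent_comp_fin_four (h.linearIndependent t.linearIndependent)
      (σ := ![3, 2, 0, 1]) (by decide))
    ?_ ?_ ?_ ?_ ?_ ?_ <;>
  simp [h.lie_left, h.lie_right_left, h.lie_right, Ring.lie_def,
    t.mul_self_left, t.mul_left_right, t.mul_right_left, t.mul_self_right]

theorem nonempty_lieEquiv_abelianLie_prod_aff (h : IsLeftMulSemidirect e j)
    (hdim : Module.finrank ℝ L = 4) (t : IsMulTable ℝ x y x 0 0 0) :
    Nonempty (L ≃ₗ⁅ℝ⁆ (AbelianLie 2 × Aff ℝ)) := by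
  refine _root_.nonempty_lieEquiv_abelianLie_prod_aff hdim
    (linearIndependent_comp_fin_four (h.linearIndependent t.linearIndependent)
      (σ := ![1, 3, 2, 0]) (by decide))
    ?_ ?_ ?_ ?_ ?_ ?_ <;>
  simp [h.lie_left, h.lie_left_right, h.lie_right_left, h.lie_right, Ring.lie_def,
    t.mul_self_left, t.mul_left_right, t.mul_right_left, t.mul_self_right]

theorem nonempty_lieEquiv_aff_prod_aff (h : IsLeftMulSemidirect e j)
    (hdim : Module.finrank ℝ L = 4) (t : IsMulTable ℝ x y x 0 0 y) :
    Nonempty (L ≃ₗ⁅ℝ⁆ (Aff ℝ × Aff ℝ)) := by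
  refine _root_.nonempty_lieEquiv_aff_prod_aff hdim
    (linearIndependent_comp_fin_four (h.linearIndependent t.linearIndependent)
      (σ := ![2, 0, 3, 1]) (by decide))
    ?_ ?_ ?_ ?_ ?_ ?_ <;>
  simp [h.lie_left, h.lie_left_right, h.lie_right_left, h.lie_right, Ring.lie_def,
    t.mul_self_left, t.mul_left_right, t.mul_right_left, t.mul_self_right]

theorem nonempty_lieEquiv_aff_complex (h : IsLeftMulSemidirect e j)
    (hdim : Module.finrank ℝ L = 4) (t : IsMulTable ℝ x y x y y (-x)) :
    Nonempty (L ≃ₗ⁅ℝ⁆ Aff ℂ) := by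
  refine _root_.nonempty_lieEquiv_aff_complex hdim
    (linearIndependent_comp_fin_four (h.linearIndependent t.linearIndependent)
      (σ := ![2, 3, 0, 1]) (by decide))
    ?_ ?_ ?_ ?_ ?_ ?_ <;>
  simp [h.lie_left, h.lie_right_left, h.lie_right, Ring.lie_def,
    t.mul_self_left, t.mul_left_right, t.mul_right_left, t.mul_self_right]

theorem nonempty_lieEquiv_lieR4_neg_one (h : IsLeftMulSemidirect e j)
    (hdim : Module.finrank ℝ L = 4) (t : IsMulTable ℝ x y x (-y) 0 0) :
    Nonempty (L ≃ₗ⁅ℝ⁆ LieR4 (-1) (-1)) := by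
  refine _root_.nonempty_lieEquiv_lieR4 hdim
    (linearIndependent_comp_fin_four (h.linearIndependent t.linearIndependent)
      (σ := ![0, 1, 3, 2]) (by decide))
    ?_ ?_ ?_ ?_ ?_ ?_ <;>
  simp [h.lie_left, h.lie_left_right, h.lie_right_left, h.lie_right, Ring.lie_def,
    t.mul_self_left, t.mul_left_right, t.mul_right_left, t.mul_self_right]

theorem nonempty_lieEquiv_lieD4_one (h : IsLeftMulSemidirect e j)
    (hdim : Module.finrank ℝ L = 4) (t : IsMulTable ℝ x y x y y 0) :
    Nonempty (L ≃ₗ⁅ℝ⁆ LieD4 1) := by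
  refine _root_.nonempty_lieEquiv_lieD4 (k := -1) (by norm_num) hdim
    (linearIndependent_comp_fin_four (h.linearIndependent t.linearIndependent)
      (σ := ![0, 3, 1, 2]) (by decide))
    ?_ ?_ ?_ ?_ ?_ ?_ <;>
  simp [h.lie_left, h.lie_left_right, h.lie_right_left, h.lie_right, Ring.lie_def,
    t.mul_self_left, t.mul_left_right, t.mul_right_left, t.mul_self_right]

theorem nonempty_lieEquiv_lieD4_two (h : IsLeftMulSemidirect e j)
    (hdim : Module.finrank ℝ L = 4) (t : IsMulTable ℝ x y ((2 : ℝ) • x) y ((2 : ℝ) • y) 0) :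
    Nonempty (L ≃ₗ⁅ℝ⁆ LieD4 2) := by
  refine _root_.nonempty_lieEquiv_lieD4 (k := -2) (by norm_num) hdim
    (linearIndependent_comp_fin_four (h.linearIndependent t.linearIndependent)
      (σ := ![0, 3, 1, 2]) (by decide))
    ?_ ?_ ?_ ?_ ?_ ?_ <;>
  simp [h.lie_left, h.lie_left_right, h.lie_right_left, h.lie_right, Ring.lie_def,
    t.mul_self_left, t.mul_left_right, t.mul_right_left, t.mul_self_right, sub_smul]

theorem nonempty_lieEquiv_lieD4_half {k : ℝ} (hk : k ≠ 0) (h : IsLeftMulSemidirect e j)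
    (hdim : Module.finrank ℝ L = 4) (t : IsMulTable ℝ x y x ((1 / 2 : ℝ) • y) 0 (k • x)) :
    Nonempty (L ≃ₗ⁅ℝ⁆ LieD4 (1 / 2)) := by
  refine _root_.nonempty_lieEquiv_lieD4 hk hdim
    (linearIndependent_comp_fin_four (h.linearIndependent t.linearIndependent)
      (σ := ![3, 1, 0, 2]) (by decide))
    ?_ ?_ ?_ ?_ ?_ ?_ <;>
  simp [h.lie_left, h.lie_right_left, h.lie_right, Ring.lie_def,
    t.mul_self_left, t.mul_left_right, t.mul_right_left, t.mul_self_right,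
    show (1 : ℝ) - 2⁻¹ = 2⁻¹ by norm_num]

end Real

end IsLeftMulSemidirect

theorem bijective_coprod_of_isCompl_range {R M N P : Type*} [Ring R] [AddCommGroup M] [Module R M]
    [AddCommGroup N] [Module R N] [AddCommGroup P] [Module R P] {f : M →ₗ[R] P} {g : N →ₗ[R] P}
    (hf : Function.Injective f) (hg : Function.Injective g) (h : IsCompl f.range g.range) :
    Function.Bijective (f.coprod g) := by
  constructor
  · rw [← LinearMap.ker_eq_bot, LinearMap.ker_coprod_of_disjoint_range _ _ h.disjoint,
      LinearMap.ker_eq_bot.2 hf, LinearMap.ker_eq_bot.2 hg, Submodule.prod_bot]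
  · rw [← LinearMap.range_eq_top, LinearMap.range_coprod, h.sup_eq_top]

namespace KahlerStructure

variable {L : Type*} [LieRing L] [LieAlgebra ℝ L] {K : KahlerStructure L} {h : LieIdeal ℝ L}

theorem J_injective (K : KahlerStructure L) : Function.Injective K.J := fun x y hxy => by
  rw [← neg_inj, ← K.J_sq, hxy, K.J_sq]

theorem metric_isSymm (K : KahlerStructure L) : LinearMap.BilinForm.IsSymm K.metric :=
  ⟨fun x y => by
    change K.ω (K.J x) y = K.ω (K.J y) x
    rw [← K.compatible (K.J x) y, K.J_sq, map_neg, LinearMap.neg_apply, K.alt.neg_eq]⟩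

theorem eq_zero_of_forall_metric_eq_zero (K : KahlerStructure L) {x : L}
    (hx : ∀ y, K.metric x y = 0) : x = 0 :=
  K.J_injective ((K.nondegenerate.1 (K.J x) hx).trans (map_zero K.J).symm)

theorem IsOrthogonalSplit.isCompl (hs : K.IsOrthogonalSplit h) :
    IsCompl h.toSubmodule (h.toSubmodule.map K.J) := by
  obtain ⟨k, hk, ⟨π, hπ, hsec⟩, -⟩ := hs
  have hker : LinearMap.ker (π : L →ₗ[ℝ] k) = h.toSubmodule := by
    ext x
    simpa using (LieHom.range_eq_ker_iff _ _).1 hπ.exact x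
  rw [← hk, ← hker]
  exact (LinearMap.isCompl_of_proj (LieHom.congr_fun hsec)).symm

theorem IsOrthogonalSplit.omega_eq_zero (hs : K.IsOrthogonalSplit h) {x y : L} (hx : x ∈ h)
    (hy : y ∈ h) : K.ω x y = 0 := by
  obtain ⟨k, hk, -, horth⟩ := hs
  have hJy : K.J y ∈ k.toSubmodule := hk ▸ Submodule.mem_map_of_mem hy
  rw [← K.compatible]
  exact horth x hx (K.J y) hJy

theorem lie_J_J (K : KahlerStructure L) {x y : L} (hxy : ⁅x, y⁆ = 0) :
    ⁅K.J x, K.J y⁆ = K.J (⁅K.J x, y⁆ - ⁅K.J y, x⁆) := by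
  have := K.integrable x y
  rw [hxy, ← lie_skew x (K.J y), map_neg] at this
  rw [map_sub]
  linear_combination (norm := module) this

theorem metric_lie_J_sub_lie_J (K : KahlerStructure L) {x y : L} (hxy : ⁅x, y⁆ = 0) (z : L) :
    K.metric (⁅K.J x, y⁆ - ⁅K.J y, x⁆) z = K.metric x ⁅K.J y, z⁆ - K.metric y ⁅K.J x, z⁆ := by
  have := K.closed (K.J x) (K.J y) z
  rw [K.lie_J_J hxy, ← lie_skew z, map_neg, LinearMap.neg_apply,
    ← K.alt.neg_eq (K.J x) ⁅K.J y, z⁆, ← K.alt.neg_eq (K.J y) ⁅K.J x, z⁆] at this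
  change K.ω (K.J _) z = K.ω (K.J x) _ - K.ω (K.J y) _
  linarith

/-- The vector space underlying an ideal `h`, regarded as an algebra with the product
`x * y = ⁅J x, y⁆`, which is left-symmetric when `h` is abelian. It is a type synonym because the
commutator of this product is not the bracket of `h`. -/
def PreLieIdeal (_K : KahlerStructure L) (h : LieIdeal ℝ L) : Type _ := h

namespace PreLieIdeal

instance : AddCommGroup (K.PreLieIdeal h) := inferInstanceAs (AddCommGroup h)

instance : Module ℝ (K.PreLieIdeal h) := inferInstanceAs (Module ℝ h)

variable (K h) in
/-- The inclusion of an ideal, regarded as an algebra, in the ambient Lie algebra. -/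
def incl : K.PreLieIdeal h →ₗ[ℝ] L := h.toSubmodule.subtype

theorem incl_injective : Function.Injective (incl K h) := Subtype.val_injective

theorem incl_mem (x : K.PreLieIdeal h) : incl K h x ∈ h := x.2

theorem range_incl : (incl K h).range = h.toSubmodule := Submodule.range_subtype _

instance : Mul (K.PreLieIdeal h) where
  mul x y := ⟨⁅K.J (incl K h x), incl K h y⁆, lie_mem_right ℝ L h _ _ (incl_mem y)⟩

theorem incl_mul (x y : K.PreLieIdeal h) :
    incl K h (x * y) = ⁅K.J (incl K h x), incl K h y⁆ := rfl

theorem lie_incl_incl [IsLieAbelian h] (x y : K.PreLieIdeal h) :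
    ⁅incl K h x, incl K h y⁆ = 0 :=
  congrArg Subtype.val (trivial_lie_zero h h x y)

instance : NonUnitalNonAssocRing (K.PreLieIdeal h) where
  left_distrib x y z := incl_injective (by simp [incl_mul])
  right_distrib x y z := incl_injective (by simp [incl_mul])
  zero_mul x := incl_injective (by simp [incl_mul])
  mul_zero x := incl_injective (by simp [incl_mul])

theorem lie_J_incl_J_incl [IsLieAbelian h] (x y : K.PreLieIdeal h) :
    ⁅K.J (incl K h x), K.J (incl K h y)⁆ = K.J (incl K h (x * y - y * x)) := by
  rw [K.lie_J_J (lie_incl_incl x y), map_sub (incl K h), incl_mul, incl_mul]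

instance [IsLieAbelian h] : LeftPreLieRing (K.PreLieIdeal h) where
  assoc_symm' x y z := incl_injective (by
    have hlie := congrArg (⁅·, incl K h z⁆) (lie_J_incl_J_incl x y)
    simp only [lie_lie, map_sub, sub_lie, ← incl_mul] at hlie
    simp only [associator_apply, map_sub]
    linear_combination (norm := module) -hlie)

instance [IsLieAbelian h] : LeftPreLieAlgebra ℝ (K.PreLieIdeal h) where
  smul_assoc r x y := incl_injective (by simp [incl_mul])
  smul_comm r x y := incl_injective (by simp [incl_mul])

theorem isLeftMulSemidirect [IsLieAbelian h] (hs : K.IsOrthogonalSplit h) :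
    IsLeftMulSemidirect (incl K h) (K.J ∘ₗ incl K h) where
  bijective := bijective_coprod_of_isCompl_range incl_injective
    (K.J_injective.comp incl_injective) (by
      rw [LinearMap.range_comp, range_incl]
      exact hs.isCompl)
  lie_left := lie_incl_incl
  lie_right_left _ _ := rfl
  lie_right x y := lie_J_incl_J_incl x y

theorem isHessianMetric [IsLieAbelian h] (hs : K.IsOrthogonalSplit h) :
    IsHessianMetric (K.metric.compl₁₂ (incl K h) (incl K h)) := by
  have hsymm : LinearMap.BilinForm.IsSymm (K.metric.compl₁₂ (incl K h) (incl K h)) :=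
    ⟨fun x y => K.metric_isSymm.eq (incl K h x) (incl K h y)⟩
  refine ⟨hsymm, hsymm.isRefl.nondegenerate_iff_separatingLeft.2 fun x hx => ?_, fun x y z => ?_⟩
  · refine incl_injective (K.eq_zero_of_forall_metric_eq_zero fun w => ?_)
    obtain ⟨⟨y, z⟩, rfl⟩ := (isLeftMulSemidirect hs).bijective.2 w
    have hz : K.metric (incl K h x) (K.J (incl K h z)) = 0 :=
      (K.compatible _ _).trans (hs.omega_eq_zero (incl_mem x) (incl_mem z))
    rw [LinearMap.coprod_apply, map_add, LinearMap.comp_apply, hz, add_zero]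
    exact hx y
  · exact K.metric_lie_J_sub_lie_J (lie_incl_incl x y) (incl K h z)

end PreLieIdeal

end KahlerStructure

theorem mainTheorem6 {L : Type*} [LieRing L] [LieAlgebra ℝ L]
    (hdim : Module.finrank ℝ L = 4) (K : KahlerStructure L)
    (h : LieIdeal ℝ L) (hab : IsLieAbelian h) (hsplit : K.IsOrthogonalSplit h) :
    Nonempty (L ≃ₗ⁅ℝ⁆ AbelianLie 4) ∨
    Nonempty (L ≃ₗ⁅ℝ⁆ (AbelianLie 1 × Heis3)) ∨
    Nonempty (L ≃ₗ⁅ℝ⁆ (AbelianLie 2 × Aff ℝ)) ∨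
    Nonempty (L ≃ₗ⁅ℝ⁆ Aff ℂ) ∨
    Nonempty (L ≃ₗ⁅ℝ⁆ (Aff ℝ × Aff ℝ)) ∨
    Nonempty (L ≃ₗ⁅ℝ⁆ LieR4 (-1) (-1)) ∨
    Nonempty (L ≃ₗ⁅ℝ⁆ LieD4 1) ∨
    Nonempty (L ≃ₗ⁅ℝ⁆ LieD4 2) ∨
    Nonempty (L ≃ₗ⁅ℝ⁆ LieD4 (1 / 2)) := by
  have : FiniteDimensional ℝ L := Module.finite_of_finrank_eq_succ hdim
  have hL := KahlerStructure.PreLieIdeal.isLeftMulSemidirect hsplit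
  have hA : Module.finrank ℝ (K.PreLieIdeal h) = 2 := by
    have := hL.two_mul_finrank
    omega
  by_cases hcomm : IsLieAbelian (K.PreLieIdeal h)
  · rcases exists_isMulTable_of_isLieAbelian hA hcomm with
      ⟨x, y, t⟩ | ⟨x, y, t⟩ | ⟨x, y, t⟩ | ⟨x, y, t⟩ | ⟨x, y, t⟩ | ⟨x, y, t⟩
    · simp only [hL.nonempty_lieEquiv_abelianLie hdim t, true_or]
    · simp only [hL.nonempty_lieEquiv_abelianLie_prod_heis3 hdim t, true_or, or_true]
    · simp only [hL.nonempty_lieEquiv_abelianLie_prod_aff hdim t, true_or, or_true]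
    · simp only [hL.nonempty_lieEquiv_aff_prod_aff hdim t, true_or, or_true]
    · simp only [hL.nonempty_lieEquiv_aff_complex hdim t, true_or, or_true]
    · simp only [hL.nonempty_lieEquiv_lieD4_one hdim t, true_or, or_true]
  · rcases (KahlerStructure.PreLieIdeal.isHessianMetric hsplit).exists_isMulTable hA hcomm with
      ⟨x, y, t⟩ | ⟨x, y, t⟩ | ⟨k, hk, x, y, t⟩
    · simp only [hL.nonempty_lieEquiv_lieR4_neg_one hdim t, true_or, or_true]
    · simp only [hL.nonempty_lieEquiv_lieD4_two hdim t, true_or, or_true]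
    · simp only [hL.nonempty_lieEquiv_lieD4_half hk hdim t, or_true]
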